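/- For a metric space $(X,d)$, the generalized roundness of $X$ is the supremum in $[0,\infty]$ of the set of all real $p\ge 0$ such that for all integers $n\ge 2$ and all (not necessarily distinct) points $x_1,\dots,x_n,y_1,\dots,y_n\in X$, $$\sum_{1\le i<j\le n}\bigl\{d(x_i,x_j)^p+d(y_i,y_j)^p\bigr\}\ \le\ \sum_{1\le i,j\le n} d(x_i,y_j)^p$$ (with the convention $0^0=1$). Let $f:X\to Y$ be a map between metric spaces $(X,d)$ and $(Y,\varsigma)$. It is a uniform embedding if it is injective and both $f$ and $f^{-1}:f(X)\to X$ are uniformly continuous. It is a Lipschitz embedding if it is injective and both $f$ and $f^{-1}:f(X)\to X$ are Lipschitz (with arbitrary constants). It is a coarse embedding if there are non-decreasing functions $\rho_1,\rho_2:[0,\infty)\to[0,\infty)$ with $\rho_1(d(x,y))\le\varsigma(f(x),f(y))\le\rho_2(d(x,y))$ for all $x,y\in X$ and $\lim_{t\to\infty}\rho_1(t)=\infty$. A metric space is locally finite if each of its balls is a finite set. A metric space $Y$ is Lipschitz universal for all locally finite metric spaces if every locally finite metric space admits a Lipschitz embedding into $Y$. The Urysohn space is the complete separable metric space $U$, unique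 up to isometry, with the following property: for every finite subset $F\subset U$ and every $g:F\to\mathbb{R}$ with $|g(x)-g(y)|\le d(x,y)\le g(x)+g(y)$ for all $x,y\in F$, there is $z\in U$ with $d(z,x)=g(x)$ for all $x\in F$. Corollary. Let $B$ be any metric space of non-zero (possibly infinite) generalized roundness. (1) The Banach space $c_0$ of real sequences converging to zero, with the supremum norm, admits neither a uniform embedding nor a coarse embedding into $B$. (2) More generally, any metric space that is Lipschitz universal for all locally finite metric spaces admits neither a uniform embedding nor a coarse embedding into $B$. (3) For example, the Urysohn space is Lipschitz universal for all locally finite metric spaces, and so admits neither a uniform embedding nor a coarse embedding into $B$. -/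

import Mathlib

open scoped NNReal ENNReal ZeroAtInfty

namespace MetricEmbedding

universe u v

/-- The inequality defining generalized roundness, for the exponent `p`: for all `n ≥ 2` and all
(not necessarily distinct) points `x₁, …, xₙ, y₁, …, yₙ`. (Here `0 ^ 0 = 1`, so `p = 0` always
satisfies it.) -/
def RoundnessInequality (X : Type u) [MetricSpace X] (p : ℝ≥0) : Prop :=
  ∀ n : ℕ, 2 ≤ n → ∀ x y : Fin n → X,
    (∑ i, ∑ j ∈ Finset.Ioi i, (dist (x i) (x j) ^ (p : ℝ) + dist (y i) (y j) ^ (p : ℝ)))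
      ≤ ∑ i, ∑ j, dist (x i) (y j) ^ (p : ℝ)

/-- The generalized roundness of a metric space, an element of `[0, ∞]`. -/
noncomputable def generalizedRoundness (X : Type u) [MetricSpace X] : ℝ≥0∞ :=
  sSup {q : ℝ≥0∞ | ∃ p : ℝ≥0, RoundnessInequality X p ∧ q = (p : ℝ≥0∞)}

/-- Coarse embeddings of metric spaces. -/
def IsCoarseEmbedding {X : Type u} {Y : Type v} [MetricSpace X] [MetricSpace Y]
    (f : X → Y) : Prop :=
  ∃ ρ₁ ρ₂ : ℝ≥0 → ℝ≥0, Monotone ρ₁ ∧ Monotone ρ₂ ∧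
    (∀ x y : X, ρ₁ (nndist x y) ≤ nndist (f x) (f y) ∧ nndist (f x) (f y) ≤ ρ₂ (nndist x y)) ∧
    Filter.Tendsto ρ₁ Filter.atTop Filter.atTop

/-- `X` is uniformly embeddable into `Y`: there is an injection `X → Y` which is uniformly
continuous and whose inverse, defined on the image, is uniformly continuous. -/
def UniformlyEmbeddable (X : Type u) (Y : Type v) [MetricSpace X] [MetricSpace Y] : Prop :=
  ∃ f : X → Y, IsUniformEmbedding f

/-- `X` is coarsely embeddable into `Y`. -/
def CoarselyEmbeddable (X : Type u) (Y : Type v) [MetricSpace X] [MetricSpace Y] : Prop :=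
  ∃ f : X → Y, IsCoarseEmbedding f

/-- Lipschitz embeddings: injections `f` such that `f` and `f⁻¹ : f(X) → X` are Lipschitz
(with arbitrary constants). -/
def IsLipschitzEmbedding {X : Type u} {Y : Type v} [MetricSpace X] [MetricSpace Y]
    (f : X → Y) : Prop :=
  Function.Injective f ∧ (∃ K : ℝ≥0, LipschitzWith K f) ∧ ∃ K : ℝ≥0, AntilipschitzWith K f

/-- A metric space is locally finite if every ball in it is a finite set. -/
def IsLocallyFinite (X : Type u) [MetricSpace X] : Prop :=
  ∀ (x : X) (r : ℝ), (Metric.closedBall x r).Finite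

/-- `Y` is Lipschitz universal for all locally finite metric spaces. (A locally finite metric
space is countable, so that spaces in `Type` represent all of them up to isometry.) -/
def LipschitzUniversalForLocallyFinite (Y : Type u) [MetricSpace Y] : Prop :=
  ∀ (Z : Type) [MetricSpace Z], IsLocallyFinite Z → ∃ f : Z → Y, IsLipschitzEmbedding f

/-- `U` is (a copy of) the Urysohn space: complete, separable, and every one-point metric
extension of a finite subset is realized in `U`. Such an extension of `s` is given by its
distance function `g`, i.e. by a function with `|g x - g y| ≤ d(x, y) ≤ g x + g y` on `s`.
The case `s = ∅` says that `U` is not empty. -/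
structure IsUrysohnSpace (U : Type u) [MetricSpace U] : Prop where
  complete : CompleteSpace U
  separable : TopologicalSpace.SeparableSpace U
  extension : ∀ (s : Finset U) (g : U → ℝ),
    (∀ x ∈ s, ∀ y ∈ s, |g x - g y| ≤ dist x y ∧ dist x y ≤ g x + g y) →
      ∃ z : U, ∀ x ∈ s, dist z x = g x

end MetricEmbedding

/-!
The obstruction is a family of finite metric spaces, the discrete tori `(ℤ / 2 ^ (k + 1)) ^ N` with
the supremum of the cyclic distances.

If `B` satisfies the generalized roundness inequality for an exponent `p > 0`, then for every map
`f` of a torus to `B` the kernel `K x y = dist (f x) (f y) ^ p` satisfies the same inequality, and so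
does its average over translations, which has the form `ψ (x - y)`. Let `w` be a random integer, let
`w'` be `0` with probability `1 / 2` and otherwise the difference of two independent copies of `w`,
and consider random vectors with independent coordinates distributed as `w` or `w'`. Choose a random
set `S` of coordinates, points `x i` whose coordinates in `S` are independent copies of `w` and whose
other coordinates vanish, and points `y i` whose coordinates outside `S` are independent copies of
`-w` and whose coordinates in `S` vanish. All differences `x i - y j` are then distributed as the
`w`-vector, while `x i - x j` and `y j - y i` are distributed as the `w'`-vector. Hence the mean of
`ψ` over the `w'`-vectors is at most its mean over the `w`-vectors (`expect_lazyDifference_le`).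

Starting from random signs, after `k` steps the increments reach `2 ^ k`, and if the dimension `N` is
large, a vector of such increments has norm `2 ^ k` with probability at least `1 / 2`. So if `f` moves
points at distance at most `1` to distance at most `a`, and points at distance `2 ^ k` to distance at
least `b`, then `b ^ p ≤ 2 * a ^ p`, independently of `k` (`rpow_le_two_mul_rpow`). Letting `k` tend
to infinity, this excludes coarse embeddings of a space containing all the tori with uniform
distortion, and, with the tori rescaled to diameter `1`, also uniform embeddings.

The space `c₀` contains every finite metric space isometrically. A space that is Lipschitz universal
for locally finite spaces contains the tori with uniform distortion, since the tori at both scales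
can be arranged in one locally finite space. In the Urysohn space every countable metric space is
copied isometrically, point by point.
-/

open scoped BigOperators

namespace MetricEmbedding

/-! ### Kernels satisfying the roundness inequality -/

/-- The kernel `K` satisfies the generalized roundness inequality for any two families of points
with the same finite index set, in averaged form: the two average self-interactions together are
at most twice the average cross-interaction. The diagonal terms are included on the left. -/
def IsRoundKernel {α : Type*} (K : α → α → ℝ) : Prop :=
  ∀ (I : Type) [Fintype I] (x y : I → α),
    (𝔼 i, 𝔼 j, K (x i) (x j)) + (𝔼 i, 𝔼 j, K (y i) (y j)) ≤ 2 * 𝔼 i, 𝔼 j, K (x i) (y j)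

lemma sum_sum_eq_two_mul_sum_Ioi {n : ℕ} (a : Fin n → Fin n → ℝ) (hs : ∀ i j, a i j = a j i)
    (h0 : ∀ i, a i i = 0) : ∑ i, ∑ j, a i j = 2 * ∑ i, ∑ j ∈ Finset.Ioi i, a i j := by
  have hflip : ∑ i, ∑ j ∈ Finset.Iio i, a i j = ∑ i, ∑ j ∈ Finset.Ioi i, a i j := by
    rw [Finset.sum_comm' (t' := Finset.univ) (s' := fun j => Finset.Ioi j) (by simp)]
    simp only [hs]
  have hrow (i : Fin n) :
      ∑ j, a i j = ∑ j ∈ Finset.Iio i, a i j + ∑ j ∈ Finset.Ioi i, a i j := by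
    have hsub : ∑ j, a i j = ∑ j ∈ Finset.univ.erase i, a i j := by
      rw [← Finset.add_sum_erase _ _ (Finset.mem_univ i), h0, zero_add]
    rw [hsub, ← Finset.sum_union]
    · congr 1
      ext j
      simp [lt_or_lt_iff_ne]
    · exact Finset.disjoint_left.2 fun j h1 h2 =>
        lt_asymm (Finset.mem_Iio.1 h1) (Finset.mem_Ioi.1 h2)
  simp only [hrow, Finset.sum_add_distrib, hflip]
  ring

/-- A positive exponent in the generalized roundness inequality makes the diagonal terms vanish,
so that the sums over `i < j` may be replaced by full double sums. -/
lemma RoundnessInequality.isRoundKernel {B : Type*} [MetricSpace B] {p : ℝ≥0}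
    (h : RoundnessInequality B p) (hp : 0 < p) :
    IsRoundKernel fun x y : B => dist x y ^ (p : ℝ) := by
  have hp' : (p : ℝ) ≠ 0 := by exact_mod_cast hp.ne'
  have key (n : ℕ) (x y : Fin n → B) :
      (∑ i, ∑ j, dist (x i) (x j) ^ (p : ℝ)) + (∑ i, ∑ j, dist (y i) (y j) ^ (p : ℝ))
        ≤ 2 * ∑ i, ∑ j, dist (x i) (y j) ^ (p : ℝ) := by
    rcases lt_or_ge n 2 with hn | hn
    · interval_cases n
      · simp
      · simp only [Fin.sum_univ_one, dist_self, Real.zero_rpow hp']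
        rw [add_zero]
        positivity
    · have := h n hn x y
      rw [sum_sum_eq_two_mul_sum_Ioi _ (fun i j => by rw [dist_comm])
          (fun i => by rw [dist_self, Real.zero_rpow hp']),
        sum_sum_eq_two_mul_sum_Ioi _ (fun i j => by rw [dist_comm])
          (fun i => by rw [dist_self, Real.zero_rpow hp'])]
      simp only [Finset.sum_add_distrib] at this
      linarith
  intro I _ x y
  have e := (Fintype.equivFin I).symm
  have hsum (u v : I → B) : ∑ i, ∑ j, dist (u (e i)) (v (e j)) ^ (p : ℝ)
      = ∑ i, ∑ j, dist (u i) (v j) ^ (p : ℝ) := by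
    rw [← Equiv.sum_comp e]
    exact Finset.sum_congr rfl fun i _ => Equiv.sum_comp e fun j => dist (u (e i)) (v j) ^ (p : ℝ)
  have := key _ (x ∘ e) (y ∘ e)
  simp only [Function.comp_apply, hsum] at this
  simp only [Fintype.expect_eq_sum_div_card, ← Finset.sum_div]
  rw [← add_div, ← add_div, mul_div_assoc', mul_div_assoc']
  gcongr

/-- Averaging a round kernel over the translations of a finite group gives a translation invariant
round kernel. -/
lemma IsRoundKernel.expect_translate {G : Type*} [AddCommGroup G] [Fintype G] {K : G → G → ℝ}
    (hK : IsRoundKernel K) : IsRoundKernel fun x y : G => 𝔼 u, K (u + x) (u + y) := by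
  intro I _ x y
  have hcomm (v w : I → G) : (𝔼 i, 𝔼 j, 𝔼 u, K (u + v i) (u + w j))
      = 𝔼 u, 𝔼 i, 𝔼 j, K (u + v i) (u + w j) := by
    rw [Finset.expect_comm (s := (Finset.univ : Finset G))]
    refine Finset.expect_congr rfl fun i _ => ?_
    rw [Finset.expect_comm]
  simp only [hcomm]
  rw [← Finset.expect_add_distrib, Finset.mul_expect]
  exact Finset.expect_le_expect fun u _ => hK I (fun i => u + x i) (fun i => u + y i)

lemma expect_translate_eq {G : Type*} [AddCommGroup G] [Fintype G] (K : G → G → ℝ) (x y : G) :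
    𝔼 u, K (u + x) (u + y) = 𝔼 u, K (u + (x - y)) u := by
  refine Fintype.expect_equiv (Equiv.addRight y) _ _ fun u => ?_
  simp only [Equiv.coe_addRight]
  congr 1
  abel

/-! ### Random vectors with growing increments -/

/-- The random increment of the next level: with probability `1 / 2` it is `0`, otherwise it is the
difference of two independent increments of the previous level. -/
def lazyDifference {Ω A : Type*} [AddCommGroup A] (w : Ω → A) : Bool × Ω × Ω → A :=
  fun t => if t.1 then w t.2.1 - w t.2.2 else 0

/-- The basic inequality: for a translation invariant round kernel on `ι → A`, replacing independent
coordinates distributed as `w` by independent coordinates distributed as `lazyDifference w` does not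
increase the average. -/
theorem expect_lazyDifference_le {ι Ω A : Type} [Fintype ι] [DecidableEq ι] [Fintype Ω] [Nonempty Ω]
    [AddCommGroup A] {ψ : (ι → A) → ℝ} (hψ : IsRoundKernel fun x y => ψ (x - y)) (w : Ω → A) :
    (𝔼 ω : ι → Bool × Ω × Ω, ψ fun c => lazyDifference w (ω c)) ≤
      𝔼 ω : ι → Ω, ψ fun c => w (ω c) := by
  -- the average for the set `S` of coordinates that are not forced to vanish
  set F : (ι → Bool) → ℝ := fun S =>
    𝔼 α : ι → Ω, 𝔼 β : ι → Ω, ψ fun c => lazyDifference w (S c, α c, β c) with hF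
  have hleft : (𝔼 ω : ι → Bool × Ω × Ω, ψ fun c => lazyDifference w (ω c)) = 𝔼 S, F S := by
    simp only [hF]
    have e2 (S : ι → Bool) : (𝔼 α : ι → Ω, 𝔼 β : ι → Ω, ψ fun c => lazyDifference w (S c, α c, β c))
        = 𝔼 q : (ι → Ω) × (ι → Ω), ψ fun c => lazyDifference w (S c, q.1 c, q.2 c) := by
      rw [← Finset.univ_product_univ, Finset.expect_product]
    simp only [e2]
    rw [← Finset.expect_product' (f := fun (S : ι → Bool) (q : (ι → Ω) × (ι → Ω)) =>
      ψ fun c => lazyDifference w (S c, q.1 c, q.2 c)), Finset.univ_product_univ]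
    exact Fintype.expect_equiv ((Equiv.arrowProdEquivProdArrow ι _ _).trans
      ((Equiv.refl _).prodCongr (Equiv.arrowProdEquivProdArrow ι _ _))) _ _ fun ω => rfl
  have hcompl : 𝔼 S, F S = 𝔼 S : ι → Bool, F fun c => !S c :=
    Fintype.expect_equiv (Equiv.arrowCongr (Equiv.refl ι) Equiv.boolNot) _ _ fun S => by
      congr 1; funext c; simp
  -- a double simplex: `x` moves the coordinates in `S`, `y` those outside `S`
  have hstep (S : ι → Bool) : F S + F (fun c => !S c) ≤ 2 * 𝔼 ω : ι → Ω, ψ fun c => w (ω c) := by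
    have h := hψ (ι → Ω) (fun α c => if S c then w (α c) else 0)
      (fun β c => if S c then 0 else - w (β c))
    have h1 : (𝔼 α : ι → Ω, 𝔼 β : ι → Ω, ψ ((fun c => if S c then w (α c) else 0) -
        fun c => if S c then w (β c) else 0)) = F S := by
      refine Finset.expect_congr rfl fun α _ => Finset.expect_congr rfl fun β _ => ?_
      congr 1; funext c
      by_cases hc : S c <;> simp [lazyDifference, hc]
    have h2 : (𝔼 α : ι → Ω, 𝔼 β : ι → Ω, ψ ((fun c => if S c then 0 else - w (α c)) -
        fun c => if S c then 0 else - w (β c))) = F fun c => !S c := by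
      rw [Finset.expect_comm]
      refine Finset.expect_congr rfl fun α _ => Finset.expect_congr rfl fun β _ => ?_
      congr 1; funext c
      by_cases hc : S c <;> simp [lazyDifference, hc, sub_eq_add_neg, add_comm]
    have h3 : (𝔼 α : ι → Ω, 𝔼 β : ι → Ω, ψ ((fun c => if S c then w (α c) else 0) -
        fun c => if S c then 0 else - w (β c))) = 𝔼 ω : ι → Ω, ψ fun c => w (ω c) := by
      -- exchanging the coordinates outside `S` makes the cross difference depend on one variable
      have hinv : Function.Involutive fun q : (ι → Ω) × (ι → Ω) =>
          ((fun c => if S c then q.1 c else q.2 c, fun c => if S c then q.2 c else q.1 c) :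
            (ι → Ω) × (ι → Ω)) := by
        intro q
        ext c <;> by_cases hc : S c <;> simp [hc]
      rw [← Finset.expect_product' (f := fun α β : ι → Ω => ψ ((fun c => if S c then w (α c) else 0) -
        fun c => if S c then 0 else - w (β c))), Finset.univ_product_univ,
        Fintype.expect_equiv (hinv.toPerm _) _
          (fun q : (ι → Ω) × (ι → Ω) => ψ fun c => w (q.1 c)), ← Finset.univ_product_univ,
        Finset.expect_product]
      · simp
      · intro q
        congr 1; funext c
        by_cases hc : S c <;> simp [hc]
    simp only [h1, h2, h3] at h
    exact h
  have havg : (𝔼 S, F S) + (𝔼 S : ι → Bool, F fun c => !S c) ≤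
      2 * 𝔼 ω : ι → Ω, ψ fun c => w (ω c) := by
    rw [← Finset.expect_add_distrib]
    exact Finset.expect_le Finset.univ_nonempty fun S _ => hstep S
  rw [hleft]
  linarith [hcompl]

lemma map_lazyDifference {Ω A A' : Type*} [AddCommGroup A] [AddCommGroup A'] (τ : A →+ A')
    (w : Ω → A) (t : Bool × Ω × Ω) :
    τ (lazyDifference w t) = lazyDifference (fun a => τ (w a)) t := by
  unfold lazyDifference
  split_ifs <;> simp

/-- Iterating `lazyDifference` from random signs: there are finitely supported increments which take
the values `2 ^ k` and `- 2 ^ k`, and whose averages are bounded by those of random signs, whatever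
the dimension. -/
theorem exists_increment (k : ℕ) : ∃ (Ω : Type) (_ : Fintype Ω) (w : Ω → ℤ) (a b : Ω),
    w a = 2 ^ k ∧ w b = - 2 ^ k ∧
      ∀ (N : ℕ) (A : Type) [AddCommGroup A] (τ : ℤ →+ A) (ψ : (Fin N → A) → ℝ),
        IsRoundKernel (fun x y => ψ (x - y)) →
        (𝔼 ω : Fin N → Ω, ψ fun c => τ (w (ω c))) ≤
          𝔼 ω : Fin N → Bool, ψ fun c => τ (if ω c then 1 else -1) := by
  induction k with
  | zero => exact ⟨Bool, inferInstance, fun t => if t then 1 else -1, true, false, by simp, by simp,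
      fun N A _ τ ψ _ => le_rfl⟩
  | succ k ih =>
    obtain ⟨Ω, _, w, a, b, ha, hb, h⟩ := ih
    refine ⟨Bool × Ω × Ω, inferInstance, lazyDifference w, (true, a, b), (true, b, a), ?_, ?_, ?_⟩
    · simp [lazyDifference, ha, hb]; ring
    · simp [lazyDifference, ha, hb]; ring
    · intro N A _ τ ψ hψ
      have : Nonempty Ω := ⟨a⟩
      refine le_trans ?_ (h N A τ ψ hψ)
      simp only [map_lazyDifference]
      exact expect_lazyDifference_le hψ fun t => τ (w t)

/-- In high dimension most words contain a given letter. -/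
lemma exists_half_le_expect_mem (Ω : Type) [Fintype Ω] (a : Ω) :
    ∃ N : ℕ, ∀ P : (Fin N → Ω) → Prop, ∀ [DecidablePred P], (∀ ω c, ω c = a → P ω) →
      (1 / 2 : ℝ) ≤ 𝔼 ω, if P ω then (1 : ℝ) else 0 := by
  classical
  have hcard : (0 : ℝ) < Fintype.card Ω := by
    have : Nonempty Ω := ⟨a⟩
    exact_mod_cast Fintype.card_pos
  obtain ⟨N, hN⟩ := exists_pow_lt_of_lt_one (show (0 : ℝ) < 1 / 2 by norm_num)
    (show ((Fintype.card Ω - 1 : ℝ) / Fintype.card Ω) < 1 by rw [div_lt_one hcard]; linarith)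
  refine ⟨N, fun P _ hP => ?_⟩
  have hsub : (Finset.univ.filter fun ω : Fin N → Ω => ¬ P ω) ⊆
      Fintype.piFinset fun _ : Fin N => Finset.univ.erase a := by
    intro ω hω
    simp only [Finset.mem_filter, Finset.mem_univ, true_and] at hω
    simp only [Fintype.mem_piFinset, Finset.mem_erase, Finset.mem_univ, and_true]
    exact fun c hc => hω (hP ω c hc)
  have hbad : ((Finset.univ.filter fun ω : Fin N → Ω => ¬ P ω).card : ℝ)
      ≤ (Fintype.card Ω - 1 : ℝ) ^ N := by
    have h1 := Finset.card_le_card hsub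
    rw [Fintype.card_piFinset] at h1
    simp only [Finset.card_erase_of_mem (Finset.mem_univ a), Finset.prod_const, Finset.card_univ,
      Fintype.card_fin] at h1
    have h2 : 1 ≤ Fintype.card Ω := by exact_mod_cast hcard
    calc _ ≤ (((Fintype.card Ω - 1) ^ N : ℕ) : ℝ) := by exact_mod_cast h1
      _ = _ := by push_cast [Nat.cast_sub h2]; rfl
  have htot := Finset.card_filter_add_card_filter_not (s := (Finset.univ : Finset (Fin N → Ω))) P
  rw [Finset.card_univ, Fintype.card_fun, Fintype.card_fin] at htot
  have htot' : ((Finset.univ.filter fun ω : Fin N → Ω => P ω).card : ℝ) +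
      (Finset.univ.filter fun ω : Fin N → Ω => ¬ P ω).card = (Fintype.card Ω : ℝ) ^ N := by
    exact_mod_cast htot
  rw [div_pow, div_lt_iff₀ (pow_pos hcard N)] at hN
  rw [Fintype.expect_eq_sum_div_card, Finset.sum_boole, Fintype.card_fun, Fintype.card_fin,
    Nat.cast_pow, le_div_iff₀ (pow_pos hcard N)]
  linarith

/-! ### Discrete tori -/

/-- The supremum distance on the discrete torus `(ℤ / M) ^ N`, each coordinate measured by the
cyclic distance. -/
def torusDist {N M : ℕ} (x y : Fin N → ZMod M) : ℕ :=
  Finset.univ.sup fun c => (x c - y c).valMinAbs.natAbs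

lemma torusDist_le_iff {N M : ℕ} {x y : Fin N → ZMod M} {r : ℕ} :
    torusDist x y ≤ r ↔ ∀ c, (x c - y c).valMinAbs.natAbs ≤ r := by
  simp [torusDist]

lemma le_torusDist {N M : ℕ} (x y : Fin N → ZMod M) (c : Fin N) :
    (x c - y c).valMinAbs.natAbs ≤ torusDist x y :=
  torusDist_le_iff.1 le_rfl c

lemma torusDist_self {N M : ℕ} (x : Fin N → ZMod M) : torusDist x x = 0 := by
  have : torusDist x x ≤ 0 := torusDist_le_iff.2 fun c => by simp
  omega

lemma torusDist_comm {N M : ℕ} (x y : Fin N → ZMod M) : torusDist x y = torusDist y x := by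
  unfold torusDist
  congr 1; funext c
  rw [← ZMod.natAbs_valMinAbs_neg, neg_sub]

lemma torusDist_triangle {N M : ℕ} (x y z : Fin N → ZMod M) :
    torusDist x z ≤ torusDist x y + torusDist y z := by
  refine torusDist_le_iff.2 fun c => ?_
  have h := ZMod.natAbs_valMinAbs_add_le (x c - y c) (y c - z c)
  rw [sub_add_sub_cancel] at h
  exact (h.trans (Int.natAbs_add_le _ _)).trans
    (add_le_add (le_torusDist x y c) (le_torusDist y z c))

lemma natAbs_valMinAbs_two_pow (k : ℕ) :
    (((2 ^ k : ℕ) : ZMod (2 ^ (k + 1))).valMinAbs).natAbs = 2 ^ k := by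
  rw [ZMod.valMinAbs_natCast_of_le_half (by rw [pow_succ]; omega)]
  simp

lemma natAbs_valMinAbs_one_le (k : ℕ) : ((1 : ZMod (2 ^ (k + 1))).valMinAbs).natAbs ≤ 1 := by
  have h : ((1 : ℕ) : ZMod (2 ^ (k + 1))).valMinAbs = (1 : ℕ) :=
    ZMod.valMinAbs_natCast_of_le_half (by
      have := Nat.one_le_two_pow (n := k)
      rw [pow_succ]; omega)
  rw [Nat.cast_one] at h
  simp [h]

/-- In a discrete torus of high dimension, a round kernel cannot be much larger at distance `2 ^ k`
than it is at distance at most `1`. -/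
theorem exists_dim_kernel_le (k : ℕ) : ∃ N : ℕ,
    ∀ K : (Fin N → ZMod (2 ^ (k + 1))) → (Fin N → ZMod (2 ^ (k + 1))) → ℝ, IsRoundKernel K →
      (∀ x y, 0 ≤ K x y) → ∀ a b : ℝ, 0 ≤ b → (∀ x y, torusDist x y ≤ 1 → K x y ≤ a) →
        (∀ x y, 2 ^ k ≤ torusDist x y → b ≤ K x y) → b ≤ 2 * a := by
  classical
  obtain ⟨Ω, _, w, o, -, ho, -, hw⟩ := exists_increment k
  obtain ⟨N, hN⟩ := exists_half_le_expect_mem Ω o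
  refine ⟨N, fun K hK hK0 a b hb hnear hfar => ?_⟩
  set ψ : (Fin N → ZMod (2 ^ (k + 1))) → ℝ := fun g => 𝔼 u, K (u + g) u with hψ
  have hround : IsRoundKernel fun x y => ψ (x - y) := by
    simpa only [expect_translate_eq] using hK.expect_translate
  have hmain := hw N _ (Int.castAddHom (ZMod (2 ^ (k + 1)))) ψ hround
  have hup : (𝔼 ω : Fin N → Bool, ψ fun c =>
      Int.castAddHom (ZMod (2 ^ (k + 1))) (if ω c then 1 else -1)) ≤ a := by
    refine Finset.expect_le Finset.univ_nonempty fun ω _ =>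
      Finset.expect_le Finset.univ_nonempty fun u _ => hnear _ _ (torusDist_le_iff.2 fun c => ?_)
    by_cases hc : ω c
    · simpa [hc] using natAbs_valMinAbs_one_le k
    · simpa [hc, ZMod.natAbs_valMinAbs_neg] using natAbs_valMinAbs_one_le k
  have hlow : b * (1 / 2) ≤ 𝔼 ω : Fin N → Ω, ψ fun c =>
      Int.castAddHom (ZMod (2 ^ (k + 1))) (w (ω c)) := by
    calc b * (1 / 2) ≤ b * 𝔼 ω : Fin N → Ω, (if ∃ c, ω c = o then (1 : ℝ) else 0) := by
          gcongr
          exact hN _ fun ω c hc => ⟨c, hc⟩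
      _ = 𝔼 ω : Fin N → Ω, b * (if ∃ c, ω c = o then (1 : ℝ) else 0) := Finset.mul_expect _ _ _
      _ ≤ _ := by
        refine Finset.expect_le_expect fun ω _ => ?_
        split_ifs with h
        · obtain ⟨c, hc⟩ := h
          rw [mul_one]
          refine Finset.le_expect Finset.univ_nonempty fun u _ => hfar _ _ ?_
          refine le_trans ?_ (le_torusDist _ _ c)
          have := natAbs_valMinAbs_two_pow k
          push_cast at this
          simp [hc, ho, this]
        · rw [mul_zero]
          exact Finset.expect_nonneg fun u _ => hK0 _ _
  linarith

/-- The dimension in which the discrete torus `(ℤ / 2 ^ (k + 1)) ^ N` is used. -/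
noncomputable def torusDim (k : ℕ) : ℕ := (exists_dim_kernel_le k).choose

/-- The discrete torus of diameter `2 ^ k` and sufficiently high dimension. -/
abbrev DiscreteTorus (k : ℕ) : Type := Fin (torusDim k) → ZMod (2 ^ (k + 1))

/-- For a map of the discrete torus into a space of positive generalized roundness, the distances of
the images of points at distance `2 ^ k` are controlled by those of points at distance at most `1`,
uniformly in `k`. -/
theorem rpow_le_two_mul_rpow {B : Type*} [MetricSpace B] {p : ℝ≥0} (hB : RoundnessInequality B p)
    (hp : 0 < p) {k : ℕ} (f : DiscreteTorus k → B) {a b : ℝ} (hb : 0 ≤ b)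
    (hnear : ∀ x y, torusDist x y ≤ 1 → dist (f x) (f y) ≤ a)
    (hfar : ∀ x y, 2 ^ k ≤ torusDist x y → b ≤ dist (f x) (f y)) :
    b ^ (p : ℝ) ≤ 2 * a ^ (p : ℝ) := by
  refine (exists_dim_kernel_le k).choose_spec (fun x y => dist (f x) (f y) ^ (p : ℝ))
    (fun I _ x y => hB.isRoundKernel hp I (f ∘ x) (f ∘ y)) (fun x y => by positivity) _ _
    (by positivity) (fun x y h => ?_) (fun x y h => ?_)
  · exact Real.rpow_le_rpow dist_nonneg (hnear x y h) p.2
  · exact Real.rpow_le_rpow hb (hfar x y h) p.2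

/-! ### Spaces containing the discrete tori -/

/-- `X` contains the discrete tori, with the metric `torusDist` itself and with the metric rescaled
to diameter `1`, up to a uniform distortion. -/
def ContainsTori (X : Type*) [MetricSpace X] : Prop :=
  ∃ C : ℝ, 0 < C ∧ ∀ k : ℕ, ∀ s : ℝ, s = 1 ∨ s = (2 ^ k)⁻¹ → ∃ φ : DiscreteTorus k → X, ∀ x y,
    dist (φ x) (φ y) ≤ C * (s * torusDist x y) ∧ s * torusDist x y ≤ C * dist (φ x) (φ y)

lemma exists_pos_roundnessInequality {B : Type*} [MetricSpace B] (h : generalizedRoundness B ≠ 0) :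
    ∃ p : ℝ≥0, 0 < p ∧ RoundnessInequality B p := by
  by_contra! hcon
  refine h (le_antisymm (sSup_le ?_) bot_le)
  rintro _ ⟨p, hp, rfl⟩
  rcases eq_or_ne p 0 with rfl | h0
  · simp
  · exact absurd hp (hcon p (pos_iff_ne_zero.2 h0))

theorem ContainsTori.not_coarselyEmbeddable {X B : Type*} [MetricSpace X] [MetricSpace B]
    (hX : ContainsTori X) (hB : generalizedRoundness B ≠ 0) : ¬ CoarselyEmbeddable X B := by
  rintro ⟨f, ρ₁, ρ₂, hρ₁, hρ₂, hf, hlim⟩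
  obtain ⟨p, hp, hR⟩ := exists_pos_roundnessInequality hB
  obtain ⟨C, hC, hX⟩ := hX
  lift C to ℝ≥0 using hC.le
  have hC' : 0 < C := by exact_mod_cast hC
  have hbound (k : ℕ) : (ρ₁ (2 ^ k / C) : ℝ) ^ (p : ℝ) ≤ 2 * (ρ₂ C : ℝ) ^ (p : ℝ) := by
    obtain ⟨φ, hφ⟩ := hX k 1 (Or.inl rfl)
    refine rpow_le_two_mul_rpow hR hp (f ∘ φ) (by positivity) (fun x y h => ?_) (fun x y h => ?_)
    · rw [Function.comp_apply, Function.comp_apply, ← coe_nndist]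
      refine NNReal.coe_le_coe.2 ((hf _ _).2.trans (hρ₂ ?_))
      rw [← NNReal.coe_le_coe, coe_nndist]
      refine (hφ x y).1.trans ?_
      have : (torusDist x y : ℝ) ≤ 1 := by exact_mod_cast h
      nlinarith
    · rw [Function.comp_apply, Function.comp_apply, ← coe_nndist]
      refine NNReal.coe_le_coe.2 (le_trans (hρ₁ ?_) (hf _ _).1)
      rw [← NNReal.coe_le_coe, coe_nndist, NNReal.coe_div, div_le_iff₀ hC]
      have : (2 : ℝ) ^ k ≤ torusDist x y := by exact_mod_cast h
      have := (hφ x y).2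
      push_cast
      linarith
  have hpow : Filter.Tendsto (fun k : ℕ => (2 : ℝ≥0) ^ k / C) Filter.atTop Filter.atTop :=
    (tendsto_pow_atTop_atTop_of_one_lt (by norm_num)).atTop_div_const hC'
  have hcoe : Filter.Tendsto (fun k : ℕ => (ρ₁ (2 ^ k / C) : ℝ)) Filter.atTop Filter.atTop :=
    NNReal.tendsto_coe_atTop.2 (hlim.comp hpow)
  have hfin := (tendsto_rpow_atTop (y := (p : ℝ)) (by exact_mod_cast hp)).comp hcoe
  obtain ⟨k, hk⟩ := (hfin.eventually_gt_atTop (2 * (ρ₂ C : ℝ) ^ (p : ℝ))).exists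
  exact absurd (hbound k) (not_le.2 hk)

theorem ContainsTori.not_uniformlyEmbeddable {X B : Type*} [MetricSpace X] [MetricSpace B]
    (hX : ContainsTori X) (hB : generalizedRoundness B ≠ 0) : ¬ UniformlyEmbeddable X B := by
  rintro ⟨f, hf⟩
  obtain ⟨p, hp, hR⟩ := exists_pos_roundnessInequality hB
  have hp' : (0 : ℝ) < p := by exact_mod_cast hp
  obtain ⟨C, hC, hX⟩ := hX
  obtain ⟨-, huc, hinv⟩ := Metric.isUniformEmbedding_iff.1 hf
  obtain ⟨δ, hδ, hinv⟩ := hinv C⁻¹ (by positivity)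
  -- `ε` is chosen such that `2 * ε ^ p < δ ^ p`
  obtain ⟨ε, hε, hεδ⟩ : ∃ ε : ℝ, 0 < ε ∧ 2 * ε ^ (p : ℝ) < δ ^ (p : ℝ) := by
    refine ⟨(δ ^ (p : ℝ) / 3) ^ (p : ℝ)⁻¹, by positivity, ?_⟩
    rw [Real.rpow_inv_rpow (by positivity) hp'.ne']
    have : 0 < δ ^ (p : ℝ) := by positivity
    linarith
  obtain ⟨η, hη, huc⟩ := Metric.uniformContinuous_iff.1 huc ε hε
  obtain ⟨k, hk⟩ := exists_pow_lt_of_lt_one (show 0 < η / C by positivity)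
    (show (2⁻¹ : ℝ) < 1 by norm_num)
  obtain ⟨φ, hφ⟩ := hX k (2 ^ k)⁻¹ (Or.inr rfl)
  rw [inv_pow, lt_div_iff₀ hC] at hk
  have hs : (0 : ℝ) < (2 ^ k)⁻¹ := by positivity
  refine absurd (rpow_le_two_mul_rpow hR hp (f ∘ φ) (a := ε) hδ.le (fun x y h => ?_)
    (fun x y h => ?_)) (not_le.2 hεδ)
  · refine (huc ((hφ x y).1.trans_lt (lt_of_le_of_lt ?_ hk))).le
    have : (torusDist x y : ℝ) ≤ 1 := by exact_mod_cast h
    rw [mul_comm C]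
    gcongr
    exact mul_le_of_le_one_right hs.le this
  · by_contra! hlt
    have h1 := hinv hlt
    have h2 : (2 : ℝ) ^ k ≤ torusDist x y := by exact_mod_cast h
    have h3 : 1 ≤ (2 ^ k : ℝ)⁻¹ * torusDist x y := by
      rw [inv_mul_eq_div, one_le_div (by positivity)]
      exact h2
    have h4 := mul_lt_mul_of_pos_left h1 hC
    rw [mul_inv_cancel₀ hC.ne'] at h4
    exact absurd (h3.trans (hφ x y).2) (not_le.2 h4)

/-! ### Tori in `c₀` and in Lipschitz universal spaces -/

/-- The Fréchet embedding of a finite (pseudo)metric space into `c₀`: a point is sent to the list of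
its distances to all points, continued by zeros. -/
lemma exists_map_zeroAtInfty {F : Type*} [Finite F] (δ : F → F → ℝ) (h0 : ∀ x, δ x x = 0)
    (hs : ∀ x y, δ x y = δ y x) (ht : ∀ x y z, δ x z ≤ δ x y + δ y z) :
    ∃ φ : F → C₀(ℕ, ℝ), ∀ x y, dist (φ x) (φ y) = δ x y := by
  have hnn (x y : F) : 0 ≤ δ x y := by linarith [ht x y x, h0 x, hs x y]
  obtain ⟨n, ⟨e⟩⟩ := Finite.exists_equiv_fin F
  let φ : F → C₀(ℕ, ℝ) := fun x =>
    { toFun := fun i => if h : i < n then δ x (e.symm ⟨i, h⟩) else 0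
      continuous_toFun := continuous_of_discreteTopology
      zero_at_infty' := by
        rw [Filter.cocompact_eq_cofinite, Nat.cofinite_eq_atTop]
        refine tendsto_const_nhds.congr' ?_
        filter_upwards [Filter.eventually_ge_atTop n] with i hi
        rw [dif_neg (not_lt.2 hi)] }
  have hφ (x y : F) : φ x (e y) = δ x y := by simp [φ]
  refine ⟨φ, fun x y => le_antisymm ?_ ?_⟩
  · rw [← ZeroAtInftyContinuousMap.dist_toBCF_eq_dist]
    refine (BoundedContinuousFunction.dist_le (hnn x y)).2 fun i => ?_
    change dist (φ x i) (φ y i) ≤ δ x y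
    by_cases hi : i < n
    · have hx := hφ x (e.symm ⟨i, hi⟩)
      have hy := hφ y (e.symm ⟨i, hi⟩)
      rw [Equiv.apply_symm_apply] at hx hy
      simp only at hx hy
      rw [hx, hy, Real.dist_eq, abs_le]
      constructor <;> linarith [ht x y (e.symm ⟨i, hi⟩), ht y x (e.symm ⟨i, hi⟩), hs x y]
    · simp [φ, hi, hnn]
  · rw [← ZeroAtInftyContinuousMap.dist_toBCF_eq_dist]
    refine le_trans ?_ (BoundedContinuousFunction.dist_coe_le_dist (e y : ℕ))
    change δ x y ≤ dist (φ x (e y)) (φ y (e y))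
    rw [hφ, hφ, h0, Real.dist_eq, sub_zero]
    exact le_abs_self _

lemma exists_torus_map_zeroAtInfty (k : ℕ) {s : ℝ} (hs : 0 ≤ s) :
    ∃ φ : DiscreteTorus k → C₀(ℕ, ℝ), ∀ x y, dist (φ x) (φ y) = s * torusDist x y := by
  refine exists_map_zeroAtInfty _ (fun x => by simp [torusDist_self])
    (fun x y => by rw [torusDist_comm]) (fun x y z => ?_)
  rw [← mul_add]
  gcongr
  exact_mod_cast torusDist_triangle x y z

theorem containsTori_zeroAtInfty : ContainsTori C₀(ℕ, ℝ) := by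
  refine ⟨1, one_pos, fun k s hs => ?_⟩
  obtain ⟨φ, hφ⟩ := exists_torus_map_zeroAtInfty k (s := s)
    (by rcases hs with rfl | rfl <;> positivity)
  exact ⟨φ, fun x y => by simp [hφ]⟩

/-- Finite subsets `S n` of a metric space, spread out by giving `S n` the height `n`, form a locally
finite space. -/
lemma isLocallyFinite_spread {W : Type*} [MetricSpace W] (S : ℕ → Set W) (hS : ∀ n, (S n).Finite) :
    IsLocallyFinite {z : ℕ × W // z.2 ∈ S z.1} := by
  intro z r
  have hfin : (⋃ n ∈ Metric.closedBall z.1.1 r, ({n} : Set ℕ) ×ˢ S n).Finite :=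
    (Set.Finite.biUnion (isCompact_closedBall _ _).finite_of_discrete fun n _ =>
      (Set.finite_singleton n).prod (hS n))
  refine Set.Finite.of_finite_image (f := Subtype.val) (hfin.subset ?_) Subtype.val_injective.injOn
  rintro _ ⟨w, hw, rfl⟩
  refine Set.mem_biUnion (x := w.1.1) ?_ ⟨rfl, w.2⟩
  have hw' : max (dist w.1.1 z.1.1) (dist w.1.2 z.1.2) ≤ r := hw
  exact (le_max_left _ _).trans hw'

theorem LipschitzUniversalForLocallyFinite.containsTori {X : Type*} [MetricSpace X]
    (hX : LipschitzUniversalForLocallyFinite X) : ContainsTori X := by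
  choose φ₁ hφ₁ using fun k => exists_torus_map_zeroAtInfty k (s := 1) zero_le_one
  choose φ₂ hφ₂ using fun k => exists_torus_map_zeroAtInfty k (s := (2 ^ k)⁻¹) (by positivity)
  set S : ℕ → Set C₀(ℕ, ℝ) := fun k => Set.range (φ₁ k) ∪ Set.range (φ₂ k) with hS
  obtain ⟨f, -, ⟨K₁, h₁⟩, K₂, h₂⟩ := hX {z : ℕ × C₀(ℕ, ℝ) // z.2 ∈ S z.1}
    (isLocallyFinite_spread S fun k => (Set.finite_range _).union (Set.finite_range _))
  have hdist (k : ℕ) (a b : C₀(ℕ, ℝ)) (ha : a ∈ S k) (hb : b ∈ S k) :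
      dist (⟨(k, a), ha⟩ : {z : ℕ × C₀(ℕ, ℝ) // z.2 ∈ S z.1}) ⟨(k, b), hb⟩ = dist a b := by
    rw [Subtype.dist_eq, Prod.dist_eq, dist_self, max_eq_right dist_nonneg]
  refine ⟨K₁ + K₂ + 1, by positivity, fun k s hs => ?_⟩
  obtain ⟨φ, hφS, hφ⟩ : ∃ φ : DiscreteTorus k → C₀(ℕ, ℝ), (∀ x, φ x ∈ S k) ∧
      ∀ x y, dist (φ x) (φ y) = s * torusDist x y := by
    rcases hs with rfl | rfl
    · exact ⟨φ₁ k, fun x => Or.inl ⟨x, rfl⟩, hφ₁ k⟩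
    · exact ⟨φ₂ k, fun x => Or.inr ⟨x, rfl⟩, hφ₂ k⟩
  refine ⟨fun x => f ⟨(k, φ x), hφS x⟩, fun x y => ?_⟩
  have e₁ := h₁.dist_le_mul ⟨(k, φ x), hφS x⟩ ⟨(k, φ y), hφS y⟩
  have e₂ := h₂.le_mul_dist ⟨(k, φ x), hφS x⟩ ⟨(k, φ y), hφS y⟩
  rw [hdist] at e₁ e₂
  rw [← hφ]
  have hK₁ : (0 : ℝ) ≤ K₁ := K₁.2
  have hK₂ : (0 : ℝ) ≤ K₂ := K₂.2
  constructor
  · refine e₁.trans (mul_le_mul_of_nonneg_right (by linarith) dist_nonneg)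
  · refine e₂.trans (mul_le_mul_of_nonneg_right (by linarith) dist_nonneg)

/-! ### Universality of the Urysohn space -/

/-- A sequence in `U` copying the distances of the sequence `e`, each term being chosen by the
extension property; a term is arbitrary if no suitable point exists. -/
noncomputable def copySeq {Z U : Type*} [MetricSpace Z] [MetricSpace U] [Nonempty U] (e : ℕ → Z) :
    ℕ → U
  | n => Classical.epsilon fun z => ∀ m : Fin n, dist z (copySeq e m) = dist (e n) (e m)
termination_by n => n
decreasing_by exact m.2

lemma IsUrysohnSpace.dist_copySeq {Z U : Type*} [MetricSpace Z] [MetricSpace U] [Nonempty U]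
    (hU : IsUrysohnSpace U) (e : ℕ → Z) (n : ℕ) :
    ∀ m < n, dist (copySeq e n : U) (copySeq e m) = dist (e n) (e m) := by
  classical
  induction n using Nat.strong_induction_on with
  | _ n ih =>
    set u : ℕ → U := copySeq e with hu
    have hall : ∀ i < n, ∀ j < n, dist (u i) (u j) = dist (e i) (e j) := by
      intro i hi j hj
      rcases lt_trichotomy i j with h | rfl | h
      · rw [dist_comm, ih j hj i h, dist_comm]
      · simp
      · exact ih i hi j h
    -- the distances prescribed on `u 0, …, u (n - 1)`; repetitions in `u` come from repetitions
    -- in `e`, hence cause no conflict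
    let g : U → ℝ := fun z => if h : ∃ i < n, u i = z then dist (e n) (e h.choose) else 0
    have hg : ∀ i < n, g (u i) = dist (e n) (e i) := by
      intro i hi
      have h : ∃ j < n, u j = u i := ⟨i, hi, rfl⟩
      have hj := h.choose_spec
      have heq : e h.choose = e i := by
        rw [← dist_eq_zero, ← hall _ hj.1 _ hi, hj.2, dist_self]
      simp only [g]
      rw [dif_pos h, heq]
    obtain ⟨z, hz⟩ := hU.extension ((Finset.range n).image u) g (by
      intro x hx y hy
      obtain ⟨i, hi, rfl⟩ := Finset.mem_image.1 hx
      obtain ⟨j, hj, rfl⟩ := Finset.mem_image.1 hy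
      rw [Finset.mem_range] at hi hj
      rw [hg i hi, hg j hj, hall i hi j hj]
      refine ⟨?_, dist_triangle_left _ _ _⟩
      rw [dist_comm (e n), dist_comm (e n)]
      exact abs_dist_sub_le _ _ _)
    have hex : ∃ z : U, ∀ m : Fin n, dist z (u m) = dist (e n) (e m) :=
      ⟨z, fun m => by
        rw [hz _ (Finset.mem_image_of_mem u (Finset.mem_range.2 m.2)), hg m m.2]⟩
    have hspec := Classical.epsilon_spec hex
    intro m hm
    have hn : u n = Classical.epsilon fun z : U => ∀ m : Fin n, dist z (u m) = dist (e n) (e m) := by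
      rw [hu, copySeq]
    rw [hn]
    exact hspec ⟨m, hm⟩

lemma IsLocallyFinite.countable {Z : Type*} [MetricSpace Z] (hZ : IsLocallyFinite Z) :
    Countable Z := by
  rcases isEmpty_or_nonempty Z with _ | ⟨⟨z⟩⟩
  · infer_instance
  · rw [← Set.countable_univ_iff, ← Metric.iUnion_closedBall_nat z]
    exact Set.countable_iUnion fun n => (hZ z n).countable

/-- The Urysohn space contains an isometric copy of every countable metric space, hence is Lipschitz
universal for the locally finite ones. -/
theorem IsUrysohnSpace.lipschitzUniversal {U : Type*} [MetricSpace U] (hU : IsUrysohnSpace U) :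
    LipschitzUniversalForLocallyFinite U := by
  intro Z _ hZ
  have := hZ.countable
  have : Nonempty U := ⟨(hU.extension ∅ 0 (by simp)).choose⟩
  suffices h : ∃ f : Z → U, Isometry f by
    obtain ⟨f, hf⟩ := h
    exact ⟨f, hf.injective, ⟨1, hf.lipschitz⟩, 1, hf.antilipschitz⟩
  rcases isEmpty_or_nonempty Z with _ | _
  · exact ⟨isEmptyElim, fun x => isEmptyElim x⟩
  obtain ⟨e, he⟩ := exists_surjective_nat Z
  choose σ hσ using he
  refine ⟨fun z => copySeq e (σ z), Isometry.of_dist_eq fun x y => ?_⟩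
  rcases lt_trichotomy (σ x) (σ y) with h | h | h
  · rw [dist_comm, hU.dist_copySeq e _ _ h, hσ, hσ, dist_comm]
  · rw [h, dist_self, ← hσ x, ← hσ y, h, dist_self]
  · rw [hU.dist_copySeq e _ _ h, hσ, hσ]

end MetricEmbedding

theorem corollary4p6 :
    -- the Banach space `c₀` of real null sequences with the supremum norm
    (∀ (B : Type*) [MetricSpace B], MetricEmbedding.generalizedRoundness B ≠ 0 →
      ¬ MetricEmbedding.UniformlyEmbeddable C₀(ℕ, ℝ) B ∧
      ¬ MetricEmbedding.CoarselyEmbeddable C₀(ℕ, ℝ) B) ∧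
    -- spaces that are Lipschitz universal for all locally finite metric spaces
    (∀ (X : Type*) [MetricSpace X], MetricEmbedding.LipschitzUniversalForLocallyFinite X →
      ∀ (B : Type*) [MetricSpace B], MetricEmbedding.generalizedRoundness B ≠ 0 →
        ¬ MetricEmbedding.UniformlyEmbeddable X B ∧
        ¬ MetricEmbedding.CoarselyEmbeddable X B) ∧
    -- the Urysohn space is an example
    (∀ (U : Type*) [MetricSpace U], MetricEmbedding.IsUrysohnSpace U →
      MetricEmbedding.LipschitzUniversalForLocallyFinite U ∧
      ∀ (B : Type*) [MetricSpace B], MetricEmbedding.generalizedRoundness B ≠ 0 →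
        ¬ MetricEmbedding.UniformlyEmbeddable U B ∧
        ¬ MetricEmbedding.CoarselyEmbeddable U B) := by
  open MetricEmbedding in
  exact ⟨fun B _ hB => ⟨containsTori_zeroAtInfty.not_uniformlyEmbeddable hB,
      containsTori_zeroAtInfty.not_coarselyEmbeddable hB⟩,
    fun X _ hX B _ hB => ⟨hX.containsTori.not_uniformlyEmbeddable hB,
      hX.containsTori.not_coarselyEmbeddable hB⟩,
    fun U _ hU => ⟨hU.lipschitzUniversal, fun B _ hB =>
      ⟨hU.lipschitzUniversal.containsTori.not_uniformlyEmbeddable hB,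
        hU.lipschitzUniversal.containsTori.not_coarselyEmbeddable hB⟩⟩⟩
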